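/- Let $d>1$. A ($d$-dimensional) fuzzy vector $x^*$ is given by a function $\xi:\mathbb R^d\to[0,1]$ with bounded support such that all cuts $C_\alpha(x^*)=\{\xi\ge\alpha\}$, $\alpha\in(0,1]$, and $C_0(x^*)=\overline{\{\xi>0\}}$ are non-empty, compact and convex. Sums and multiples by real numbers are defined through cuts: $C_\alpha(x^*\oplus y^*)=C_\alpha(x^*)+C_\alpha(y^*)$ (Minkowski sum), $C_\alpha(\lambda\odot x^*)=\lambda C_\alpha(x^*)$. The support function of $x^*$ is $s_{x^*}(\alpha,u)=\sup_{a\in C_\alpha(x^*)}\langle u,a\rangle$, for $\alpha\in(0,1]$ and $u\in\mathbb S^{d-1}$. Fix $p\in[1,\infty)$ and equip the set of fuzzy vectors with the metric $d_p(x^*,y^*)=\bigl(\int_0^1 d_H(C_\alpha(x^*),C_\alpha(y^*))^p\,d\alpha\bigr)^{1/p}$, where $d_H$ is the Hausdorff distance, and with its Borel $\sigma$-field. Let $X_1^*,X_2^*,\dots$ be mutually independent, identically distributed fuzzy random variables (measurable maps into this space) on a probability space. Assume that they have a Bochner expectation $m^*$, that is, $m^*$ is a fuzzy vector such that $s_{X_j^*}(\alpha,u)$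 is integrable with $s_{m^*}(\alpha,u)=\mathbf E\,s_{X_j^*}(\alpha,u)$ for all $(\alpha,u)\in(0,1]\times\mathbb S^{d-1}$, and that their Fréchet variance $$\mathbf E\int_0^1\int_{\mathbb S^{d-1}}|s_{X_j^*}(\alpha,u)-s_{m^*}(\alpha,u)|^2\,d\lambda(u)\,d\alpha$$ is finite, where $\lambda$ is the normalized Lebesgue measure on $\mathbb S^{d-1}$. Fix $(\alpha,u)\in(0,1]\times\mathbb S^{d-1}$ such that the real random variable $s_{X_1^*}(\alpha,u)$ is not almost surely constant, and put $\tilde\sigma^2=\operatorname{Var}s_{X_1^*}(\alpha,u)$. Let $S_0^*=0$, $S_k^*=X_1^*\oplus\dots\oplus X_k^*$, and for $t\ge0$, $n\ge1$, $$L_t^*=S^*_{\lfloor t\rfloor}\oplus(t-\lfloor t\rfloor)\odot X^*_{\lfloor t\rfloor+1},\qquad M_{t,n}^*=\frac1{\tilde\sigma\sqrt n}\odot L_{nt}^*,$$ $$\tilde s_{M_{t,n}^*}(\alpha,u)=s_{M_{t,n}^*}(\alpha,u)-\frac1{\tilde\sigma\sqrt n}\bigl(\lfloor nt\rfloor+(nt-\lfloor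 nt\rfloor)\bigr)s_{m^*}(\alpha,u).$$ Then for every $k\in\mathbb N$ and all times $0\le t_1<\dots<t_k$, $$\bigl(\tilde s_{M_{t_1,n}^*}(\alpha,u),\dots,\tilde s_{M_{t_k,n}^*}(\alpha,u)\bigr)\longrightarrow(b_{t_1},\dots,b_{t_k})\quad\text{in distribution as }n\to\infty,$$ where $b$ is a standard real Brownian motion. -/

import Mathlib

open MeasureTheory ProbabilityTheory Filter Topology
open scoped NNReal ENNReal Pointwise

/-- A `d`-dimensional fuzzy vector, given by its characterizing function `ξ : ℝ^d → [0,1]`: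
the support is bounded, and all `α`-cuts `{x | α ≤ ξ x}` with `0 < α ≤ 1`, as well as the closed
support `closure {x | 0 < ξ x}`, are non-empty, compact and convex. -/
structure FuzzyVector (d : ℕ) where
  /-- the characterizing function -/
  ξ : EuclideanSpace ℝ (Fin d) → ℝ
  mem_unit : ∀ x, ξ x ∈ Set.Icc (0 : ℝ) 1
  bounded_supp : Bornology.IsBounded (closure {x | 0 < ξ x})
  nonempty_cut : ∀ α ∈ Set.Ioc (0 : ℝ) 1, {x | α ≤ ξ x}.Nonempty
  compact_cut : ∀ α ∈ Set.Ioc (0 : ℝ) 1, IsCompact {x | α ≤ ξ x}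
  convex_cut : ∀ α ∈ Set.Ioc (0 : ℝ) 1, Convex ℝ {x | α ≤ ξ x}
  nonempty_supp : (closure {x | 0 < ξ x}).Nonempty
  compact_supp : IsCompact (closure {x | 0 < ξ x})
  convex_supp : Convex ℝ (closure {x | 0 < ξ x})

namespace FuzzyVector

variable {d : ℕ}

/-- The `α`-cut of a fuzzy vector, for `0 < α ≤ 1`. -/
def cut (x : FuzzyVector d) (α : ℝ) : Set (EuclideanSpace ℝ (Fin d)) := {z | α ≤ x.ξ z}

/-- The characterizing function that has a given family of sets as its cuts. -/
noncomputable def charOfCuts (C : ℝ → Set (EuclideanSpace ℝ (Fin d)))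
    (z : EuclideanSpace ℝ (Fin d)) : ℝ :=
  sSup (insert 0 {α | α ∈ Set.Ioc (0 : ℝ) 1 ∧ z ∈ C α})

theorem bddAbove_charOfCuts (C : ℝ → Set (EuclideanSpace ℝ (Fin d)))
    (z : EuclideanSpace ℝ (Fin d)) :
    BddAbove (insert 0 {α | α ∈ Set.Ioc (0 : ℝ) 1 ∧ z ∈ C α}) := by
  refine ⟨1, ?_⟩
  rintro a (rfl | ⟨h, -⟩)
  · exact zero_le_one
  · exact h.2

theorem le_charOfCuts_iff (C : ℝ → Set (EuclideanSpace ℝ (Fin d)))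
    (anti : ∀ α ∈ Set.Ioc (0 : ℝ) 1, ∀ β ∈ Set.Ioc (0 : ℝ) 1, α ≤ β → C β ⊆ C α)
    (left : ∀ α ∈ Set.Ioc (0 : ℝ) 1, ∀ z, (∀ β ∈ Set.Ioo 0 α, z ∈ C β) → z ∈ C α)
    {α : ℝ} (hα : α ∈ Set.Ioc (0 : ℝ) 1) (z : EuclideanSpace ℝ (Fin d)) :
    α ≤ charOfCuts C z ↔ z ∈ C α := by
  constructor
  · intro h
    refine left α hα z fun β hβ => ?_
    obtain ⟨γ, hγ, hlt⟩ := exists_lt_of_lt_csSup ⟨0, Set.mem_insert _ _⟩ (hβ.2.trans_le h)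
    rcases hγ with rfl | ⟨hγ, hz⟩
    · exact absurd hlt (not_lt.2 hβ.1.le)
    · exact anti β ⟨hβ.1, hβ.2.le.trans hα.2⟩ γ hγ hlt.le hz
  · intro h
    exact le_csSup (bddAbove_charOfCuts C z) (Or.inr ⟨hα, h⟩)

/-- The fuzzy vector whose `α`-cuts are the sets `C α` of a left-continuous decreasing and bounded
family of non-empty compact convex sets. -/
noncomputable def ofCuts (C : ℝ → Set (EuclideanSpace ℝ (Fin d)))
    (anti : ∀ α ∈ Set.Ioc (0 : ℝ) 1, ∀ β ∈ Set.Ioc (0 : ℝ) 1, α ≤ β → C β ⊆ C α)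
    (left : ∀ α ∈ Set.Ioc (0 : ℝ) 1, ∀ z, (∀ β ∈ Set.Ioo 0 α, z ∈ C β) → z ∈ C α)
    (ne : ∀ α ∈ Set.Ioc (0 : ℝ) 1, (C α).Nonempty)
    (cpt : ∀ α ∈ Set.Ioc (0 : ℝ) 1, IsCompact (C α))
    (cvx : ∀ α ∈ Set.Ioc (0 : ℝ) 1, Convex ℝ (C α))
    (bdd : ∃ K, Bornology.IsBounded K ∧ ∀ α ∈ Set.Ioc (0 : ℝ) 1, C α ⊆ K) :
    FuzzyVector d :=
  have key : ∀ α ∈ Set.Ioc (0 : ℝ) 1, {z | α ≤ charOfCuts C z} = C α := fun α hα =>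
    Set.ext fun z => le_charOfCuts_iff C anti left hα z
  have unit : ∀ z, charOfCuts C z ∈ Set.Icc (0 : ℝ) 1 := fun z =>
    ⟨le_csSup (bddAbove_charOfCuts C z) (Set.mem_insert _ _),
      csSup_le ⟨0, Set.mem_insert _ _⟩ (by
        rintro a (rfl | ⟨h, -⟩)
        · exact zero_le_one
        · exact h.2)⟩
  have pos : ∀ z, 0 < charOfCuts C z → z ∈ C (charOfCuts C z) := fun z hz =>
    (le_charOfCuts_iff C anti left ⟨hz, (unit z).2⟩ z).1 le_rfl
  have bd : Bornology.IsBounded (closure {z | 0 < charOfCuts C z}) := by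
    obtain ⟨K, hK, hC⟩ := bdd
    exact (hK.subset fun z hz => hC _ ⟨hz, (unit z).2⟩ (pos z hz)).closure
  { ξ := charOfCuts C
    mem_unit := unit
    bounded_supp := bd
    nonempty_cut := fun α hα => by rw [key α hα]; exact ne α hα
    compact_cut := fun α hα => by rw [key α hα]; exact cpt α hα
    convex_cut := fun α hα => by rw [key α hα]; exact cvx α hα
    nonempty_supp := by
      obtain ⟨z, hz⟩ := ne 1 ⟨one_pos, le_rfl⟩
      refine ⟨z, subset_closure ?_⟩
      exact one_pos.trans_le ((le_charOfCuts_iff C anti left ⟨one_pos, le_rfl⟩ z).2 hz)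
    compact_supp := Metric.isCompact_of_isClosed_isBounded isClosed_closure bd
    convex_supp := by
      refine Convex.closure fun z hz w hw a b ha hb hab => ?_
      have hm : min (charOfCuts C z) (charOfCuts C w) ∈ Set.Ioc (0 : ℝ) 1 :=
        ⟨lt_min hz hw, (min_le_left _ _).trans (unit z).2⟩
      have hz' := anti _ hm _ ⟨hz, (unit z).2⟩ (min_le_left _ _) (pos z hz)
      have hw' := anti _ hm _ ⟨hw, (unit w).2⟩ (min_le_right _ _) (pos w hw)
      exact hm.1.trans_le
        ((le_charOfCuts_iff C anti left hm _).2 (cvx _ hm hz' hw' ha hb hab)) }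

theorem cut_ofCuts (C : ℝ → Set (EuclideanSpace ℝ (Fin d))) (anti) (left) (ne) (cpt) (cvx) (bdd)
    {α : ℝ} (hα : α ∈ Set.Ioc (0 : ℝ) 1) :
    (ofCuts C anti left ne cpt cvx bdd).cut α = C α :=
  Set.ext fun z => le_charOfCuts_iff C anti left hα z

theorem cut_anti (x : FuzzyVector d) {α β : ℝ} (h : α ≤ β) : x.cut β ⊆ x.cut α :=
  fun _ hz => h.trans hz

theorem cut_left (x : FuzzyVector d) {α : ℝ} (hα : 0 < α) (z : EuclideanSpace ℝ (Fin d))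
    (h : ∀ β ∈ Set.Ioo 0 α, z ∈ x.cut β) : z ∈ x.cut α := by
  by_contra hz
  have hlt : x.ξ z < α := not_le.1 hz
  obtain ⟨β, h1, h2⟩ := exists_between (max_lt hα hlt)
  exact absurd (h β ⟨(le_max_left _ _).trans_lt h1, h2⟩)
    (not_le.2 ((le_max_right _ _).trans_lt h1))

theorem cut_subset_supp (x : FuzzyVector d) {α : ℝ} (hα : 0 < α) :
    x.cut α ⊆ closure {z | 0 < x.ξ z} :=
  fun _ hz => subset_closure (hα.trans_le hz)

/-- The crisp zero vector: every cut is `{0}`. -/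
noncomputable instance : Zero (FuzzyVector d) where
  zero := ofCuts (fun _ => {0}) (fun _ _ _ _ _ => subset_rfl)
    (fun α hα _ h => h (α / 2) ⟨half_pos hα.1, half_lt_self hα.1⟩)
    (fun _ _ => Set.singleton_nonempty 0) (fun _ _ => isCompact_singleton)
    (fun _ _ => convex_singleton 0) ⟨{0}, Bornology.isBounded_singleton, fun _ _ => subset_rfl⟩

/-- The fuzzy sum: the cuts are the Minkowski sums of the cuts. -/
noncomputable instance : Add (FuzzyVector d) where
  add x y := ofCuts (fun α => x.cut α + y.cut α)
    (fun _ _ _ _ h => Set.add_subset_add (x.cut_anti h) (y.cut_anti h))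
    (fun α hα z h => by
      have hβ : ∀ β : Set.Ioo 0 α, (β : ℝ) ∈ Set.Ioc (0 : ℝ) 1 := fun β =>
        ⟨β.2.1, β.2.2.le.trans hα.2⟩
      have : Nonempty (Set.Ioo 0 α) := ⟨⟨α / 2, half_pos hα.1, half_lt_self hα.1⟩⟩
      have hcl : ∀ β : Set.Ioo 0 α, IsClosed {a | z - a ∈ y.cut β} := fun β =>
        (y.compact_cut β (hβ β)).isClosed.preimage (continuous_const.sub continuous_id)
      obtain ⟨a, ha⟩ := IsCompact.nonempty_iInter_of_directed_nonempty_isCompact_isClosed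
        (fun β : Set.Ioo 0 α => x.cut β ∩ {a | z - a ∈ y.cut β})
        (Antitone.directed_ge fun β γ hle a ha =>
          ⟨x.cut_anti hle ha.1, y.cut_anti hle ha.2⟩)
        (fun β => by
          obtain ⟨a, ha, b, hb, hab⟩ := h β β.2
          refine ⟨a, ha, ?_⟩
          have hab' : a + b = z := hab
          have : z - a = b := by rw [← hab']; abel
          simpa [this] using hb)
        (fun β => (x.compact_cut β (hβ β)).inter_right (hcl β))
        (fun β => (x.compact_cut β (hβ β)).isClosed.inter (hcl β))
      rw [Set.mem_iInter] at ha
      exact ⟨a, x.cut_left hα.1 a fun β hb => (ha ⟨β, hb⟩).1, z - a,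
        y.cut_left hα.1 _ fun β hb => (ha ⟨β, hb⟩).2, add_sub_cancel a z⟩)
    (fun α hα => (x.nonempty_cut α hα).add (y.nonempty_cut α hα))
    (fun α hα => (x.compact_cut α hα).add (y.compact_cut α hα))
    (fun α hα => (x.convex_cut α hα).add (y.convex_cut α hα))
    ⟨_, x.bounded_supp.add y.bounded_supp, fun _ hα =>
      Set.add_subset_add (x.cut_subset_supp hα.1) (y.cut_subset_supp hα.1)⟩

/-- Multiplication by a crisp real number: the cuts are the dilated cuts. -/
noncomputable instance : SMul ℝ (FuzzyVector d) where
  smul c x := ofCuts (fun α => c • x.cut α)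
    (fun _ _ _ _ h => Set.smul_set_mono (x.cut_anti h))
    (fun α hα z h => by
      rcases eq_or_ne c 0 with rfl | hc
      · obtain ⟨a, -, ha⟩ := h (α / 2) ⟨half_pos hα.1, half_lt_self hα.1⟩
        obtain ⟨b, hb⟩ := x.nonempty_cut α hα
        exact ⟨b, hb, by simpa using ha⟩
      · rw [Set.mem_smul_set_iff_inv_smul_mem₀ hc]
        exact x.cut_left hα.1 _ fun β hb => (Set.mem_smul_set_iff_inv_smul_mem₀ hc _ _).1 (h β hb))
    (fun α hα => (x.nonempty_cut α hα).smul_set)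
    (fun α hα => (x.compact_cut α hα).smul c)
    (fun α hα => (x.convex_cut α hα).smul c)
    ⟨_, x.bounded_supp.smul₀ c, fun _ hα => Set.smul_set_mono (x.cut_subset_supp hα.1)⟩

theorem cut_zero {α : ℝ} (hα : α ∈ Set.Ioc (0 : ℝ) 1) : (0 : FuzzyVector d).cut α = {0} :=
  cut_ofCuts _ _ _ _ _ _ _ hα

theorem cut_add (x y : FuzzyVector d) {α : ℝ} (hα : α ∈ Set.Ioc (0 : ℝ) 1) :
    (x + y).cut α = x.cut α + y.cut α :=
  cut_ofCuts _ _ _ _ _ _ _ hα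

theorem cut_smul (c : ℝ) (x : FuzzyVector d) {α : ℝ} (hα : α ∈ Set.Ioc (0 : ℝ) 1) :
    (c • x).cut α = c • x.cut α :=
  cut_ofCuts _ _ _ _ _ _ _ hα

/-- The support function `s_x(α, u) = sup {⟪u, a⟫ | a ∈ cut x α}` on `(0,1] × S^{d-1}`. -/
noncomputable def supp (x : FuzzyVector d) (α : ℝ)
    (u : Metric.sphere (0 : EuclideanSpace ℝ (Fin d)) 1) : ℝ :=
  sSup ((fun a => inner ℝ (u : EuclideanSpace ℝ (Fin d)) a) '' x.cut α)

/-- The metric `d_p(x, y) = (∫₀¹ d_H(cut x α, cut y α)^p dα)^{1/p}`, with `d_H` the Hausdorff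
distance, as an element of `[0,∞]` (its values are finite). -/
noncomputable def dp (p : ℝ) (x y : FuzzyVector d) : ℝ≥0∞ :=
  (∫⁻ α in Set.Ioc (0 : ℝ) 1, Metric.hausdorffEDist (x.cut α) (y.cut α) ^ p) ^ (1 / p)

/-- The topology of the metric `d_p`: a set is open when it contains a `d_p`-ball around each of
its points. -/
@[reducible] def dpTopology (d : ℕ) (p : ℝ) : TopologicalSpace (FuzzyVector d) where
  IsOpen U := ∀ x ∈ U, ∃ ε : ℝ≥0∞, 0 < ε ∧ ∀ y, dp p x y < ε → y ∈ U
  isOpen_univ := fun _ _ => ⟨1, one_pos, fun _ _ => Set.mem_univ _⟩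
  isOpen_inter := fun U V hU hV x hx => by
    obtain ⟨ε, hε, h1⟩ := hU x hx.1
    obtain ⟨δ, hδ, h2⟩ := hV x hx.2
    exact ⟨min ε δ, lt_min hε hδ, fun y hy =>
      ⟨h1 y (hy.trans_le (min_le_left _ _)), h2 y (hy.trans_le (min_le_right _ _))⟩⟩
  isOpen_sUnion := fun S hS x hx => by
    obtain ⟨U, hU, hxU⟩ := hx
    obtain ⟨ε, hε, h⟩ := hS U hU x hxU
    exact ⟨ε, hε, fun y hy => ⟨U, hU, h y hy⟩⟩

/-- The Borel `σ`-field of the metric `d_p` on fuzzy vectors. -/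
@[reducible] def dpBorel (d : ℕ) (p : ℝ) : MeasurableSpace (FuzzyVector d) :=
  @borel (FuzzyVector d) (dpTopology d p)

/-- The normalized Lebesgue (surface) measure on the unit sphere of `ℝ^d`. -/
noncomputable def sphereMeasure (d : ℕ) :
    Measure (Metric.sphere (0 : EuclideanSpace ℝ (Fin d)) 1) :=
  ((volume : Measure (EuclideanSpace ℝ (Fin d))).toSphere Set.univ)⁻¹ •
    (volume : Measure (EuclideanSpace ℝ (Fin d))).toSphere

/-- The squared `L²((0,1] × S^{d-1})`-distance of the support functions. -/
noncomputable def rhoTwoSq (x y : FuzzyVector d) : ℝ≥0∞ :=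
  ∫⁻ α in Set.Ioc (0 : ℝ) 1, ∫⁻ u, ‖x.supp α u - y.supp α u‖ₑ ^ 2 ∂(sphereMeasure d)

section Random

variable {Ω : Type*} [MeasurableSpace Ω]

/-- `m` is the Bochner expectation of the fuzzy random variable `X`: for all `(α, u)` the classical
expectation of `s_X(α, u)` exists and equals `s_m(α, u)`. -/
def IsBochnerExpectation (P : Measure Ω) (X : Ω → FuzzyVector d) (m : FuzzyVector d) : Prop :=
  ∀ α ∈ Set.Ioc (0 : ℝ) 1, ∀ u : Metric.sphere (0 : EuclideanSpace ℝ (Fin d)) 1,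
    Integrable (fun ω => (X ω).supp α u) P ∧ m.supp α u = ∫ ω, (X ω).supp α u ∂P

/-- The Fréchet variance of `X` about its Bochner expectation `m`, a number in `[0,∞]`. -/
noncomputable def frechetVariance (P : Measure Ω) (X : Ω → FuzzyVector d)
    (m : FuzzyVector d) : ℝ≥0∞ :=
  ∫⁻ ω, rhoTwoSq (X ω) m ∂P

end Random

section Walk

/-- The partial sums `S_0 = 0`, `S_{k+1} = S_k ⊕ X_{k+1}`; the sequence `X_1, X_2, …` is indexed
from zero, so that `x k` stands for `X_{k+1}`. -/
noncomputable def walk (x : ℕ → FuzzyVector d) : ℕ → FuzzyVector d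
  | 0 => 0
  | k + 1 => walk x k + x k

/-- The linear interpolation `L_t = S_⌊t⌋ ⊕ (t - ⌊t⌋) ⊙ X_{⌊t⌋+1}`. -/
noncomputable def interp (x : ℕ → FuzzyVector d) (t : ℝ≥0) : FuzzyVector d :=
  walk x ⌊t⌋₊ + ((t : ℝ) - ⌊t⌋₊) • x ⌊t⌋₊

/-- The rescaled process `M_{t,n} = L_{nt} / (σ √n)`. -/
noncomputable def rescaled (x : ℕ → FuzzyVector d) (σ : ℝ) (n : ℕ) (t : ℝ≥0) : FuzzyVector d :=
  (1 / (σ * √n)) • interp x (n * t)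

/-- The centred support value
`s_{M_{t,n}}(α,u) - (⌊nt⌋ + (nt - ⌊nt⌋)) s_m(α,u) / (σ √n)`. -/
noncomputable def centredSupp (x : ℕ → FuzzyVector d) (m : FuzzyVector d) (σ : ℝ) (n : ℕ) (t : ℝ≥0)
    (α : ℝ) (u : Metric.sphere (0 : EuclideanSpace ℝ (Fin d)) 1) : ℝ :=
  (rescaled x σ n t).supp α u -
    1 / (σ * √n) * ((⌊n * t⌋₊ : ℝ) + ((n * t : ℝ) - ⌊n * t⌋₊)) * m.supp α u

end Walk

end FuzzyVector

/-! ### Algebra of support functions at a fixed level and direction. -/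

namespace FuzzyVector

variable {d : ℕ}

/-! For fixed `(α, u)` the support value is additive and positively homogeneous, so `centredSupp_eq`
turns the fuzzy walk into the interpolated real walk with steps `Y_j = (s_{X_j} - s_m) / σ`. What
remains is the finite-dimensional part of Donsker's theorem, once the `Y_j` are known to be i.i.d.
and square integrable.

Neither fact is immediate, since `d_p` and the Fréchet variance only see averages over levels. For
`measurable_supp`, averages over `(α - ε, α]` are `d_p`-Lipschitz and converge to the value at `α`
by left-continuity. For `exists_enorm_supp_sq_le`, a maximiser `z` in the `α`-cut lies in all lower
cuts, so `⟨v, z⟩ ≤ s_x(β, v)` for all `β ≤ α` and all `v`; averaging the squared positive part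
bounds `‖z‖²`.

In `tendstoInDistribution_interpolated_walk`, a linear combination of the walk at several times is a
weighted sum of the `Y_j` with uniformly small weights. Their sum of squares tends to the Brownian
covariance form, so `tendsto_prod_charFun` gives the Gaussian characteristic function. -/

theorem isCompact_cut (x : FuzzyVector d) {α : ℝ} (hα : α ∈ Set.Ioc (0 : ℝ) 1) :
    IsCompact (x.cut α) := x.compact_cut α hα

theorem cut_nonempty (x : FuzzyVector d) {α : ℝ} (hα : α ∈ Set.Ioc (0 : ℝ) 1) :
    (x.cut α).Nonempty := x.nonempty_cut α hα

theorem isCompact_image_cut (x : FuzzyVector d) {α : ℝ} (hα : α ∈ Set.Ioc (0 : ℝ) 1)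
    (v : EuclideanSpace ℝ (Fin d)) : IsCompact ((fun a => inner ℝ v a) '' x.cut α) :=
  (x.isCompact_cut hα).image (by fun_prop)

theorem inner_le_supp (x : FuzzyVector d) {α : ℝ} (hα : α ∈ Set.Ioc (0 : ℝ) 1)
    (u : Metric.sphere (0 : EuclideanSpace ℝ (Fin d)) 1) {a : EuclideanSpace ℝ (Fin d)}
    (ha : a ∈ x.cut α) : inner ℝ (u : EuclideanSpace ℝ (Fin d)) a ≤ x.supp α u :=
  le_csSup (x.isCompact_image_cut hα u).bddAbove ⟨a, ha, rfl⟩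

theorem exists_inner_eq_supp (x : FuzzyVector d) {α : ℝ} (hα : α ∈ Set.Ioc (0 : ℝ) 1)
    (u : Metric.sphere (0 : EuclideanSpace ℝ (Fin d)) 1) :
    ∃ a ∈ x.cut α, inner ℝ (u : EuclideanSpace ℝ (Fin d)) a = x.supp α u :=
  (x.isCompact_image_cut hα u).sSup_mem ((x.cut_nonempty hα).image _)

theorem supp_zero {α : ℝ} (hα : α ∈ Set.Ioc (0 : ℝ) 1)
    (u : Metric.sphere (0 : EuclideanSpace ℝ (Fin d)) 1) : (0 : FuzzyVector d).supp α u = 0 := by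
  simp [supp, cut_zero hα]

theorem supp_add (x y : FuzzyVector d) {α : ℝ} (hα : α ∈ Set.Ioc (0 : ℝ) 1)
    (u : Metric.sphere (0 : EuclideanSpace ℝ (Fin d)) 1) :
    (x + y).supp α u = x.supp α u + y.supp α u := by
  refine le_antisymm ?_ ?_
  · obtain ⟨c, hc, h⟩ := (x + y).exists_inner_eq_supp hα u
    rw [cut_add x y hα] at hc
    obtain ⟨a, ha, b, hb, rfl⟩ := hc
    rw [← h, inner_add_right]
    exact add_le_add (x.inner_le_supp hα u ha) (y.inner_le_supp hα u hb)
  · obtain ⟨a, ha, h⟩ := x.exists_inner_eq_supp hα u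
    obtain ⟨b, hb, h'⟩ := y.exists_inner_eq_supp hα u
    rw [← h, ← h', ← inner_add_right]
    refine (x + y).inner_le_supp hα u ?_
    rw [cut_add x y hα]
    exact Set.add_mem_add ha hb

/-- The sign matters: a negative factor would replace `u` by `-u`. -/
theorem supp_smul {c : ℝ} (hc : 0 ≤ c) (x : FuzzyVector d) {α : ℝ} (hα : α ∈ Set.Ioc (0 : ℝ) 1)
    (u : Metric.sphere (0 : EuclideanSpace ℝ (Fin d)) 1) :
    (c • x).supp α u = c * x.supp α u := by
  refine le_antisymm ?_ ?_
  · obtain ⟨b, hb, h⟩ := (c • x).exists_inner_eq_supp hα u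
    rw [cut_smul c x hα] at hb
    obtain ⟨a, ha, rfl⟩ := hb
    rw [← h, inner_smul_right]
    exact mul_le_mul_of_nonneg_left (x.inner_le_supp hα u ha) hc
  · obtain ⟨a, ha, h⟩ := x.exists_inner_eq_supp hα u
    rw [← h, ← inner_smul_right]
    refine (c • x).inner_le_supp hα u ?_
    rw [cut_smul c x hα]
    exact Set.smul_mem_smul_set ha

theorem supp_walk (x : ℕ → FuzzyVector d) {α : ℝ} (hα : α ∈ Set.Ioc (0 : ℝ) 1)
    (u : Metric.sphere (0 : EuclideanSpace ℝ (Fin d)) 1) (k : ℕ) :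
    (walk x k).supp α u = ∑ j ∈ Finset.range k, (x j).supp α u := by
  induction k with
  | zero => simp [walk, supp_zero hα]
  | succ k ih => rw [walk, supp_add _ _ hα, ih, Finset.sum_range_succ]

/-- The centred support value is the rescaled linear interpolation of the partial sums of the
centred support functions of the steps. -/
theorem centredSupp_eq (x : ℕ → FuzzyVector d) (m : FuzzyVector d) {σ : ℝ} (hσ : 0 ≤ σ) (n : ℕ)
    (t : ℝ≥0) {α : ℝ} (hα : α ∈ Set.Ioc (0 : ℝ) 1)
    (u : Metric.sphere (0 : EuclideanSpace ℝ (Fin d)) 1) :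
    centredSupp x m σ n t α u = (√n)⁻¹ *
      (∑ j ∈ Finset.range ⌊n * t⌋₊, ((x j).supp α u - m.supp α u) / σ +
        ((n * t : ℝ) - ⌊n * t⌋₊) * (((x ⌊n * t⌋₊).supp α u - m.supp α u) / σ)) := by
  have hfl : (⌊n * t⌋₊ : ℝ) ≤ ((n * t : ℝ≥0) : ℝ) := by
    exact_mod_cast Nat.floor_le (zero_le (a := (n * t : ℝ≥0)))
  rw [centredSupp, rescaled, supp_smul (by positivity) _ hα, interp, supp_add _ _ hα,
    supp_smul (sub_nonneg.2 hfl) _ hα, supp_walk _ hα, ← Finset.sum_div, Finset.sum_sub_distrib]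
  push_cast
  simp only [Finset.sum_const, Finset.card_range, nsmul_eq_mul, one_div, mul_inv]
  ring

/-! ### Borel measurability of support values for `d_p`. -/

theorem supp_le_supp_add_hausdorff (x y : FuzzyVector d) {α : ℝ} (hα : α ∈ Set.Ioc (0 : ℝ) 1)
    (u : Metric.sphere (0 : EuclideanSpace ℝ (Fin d)) 1) :
    ENNReal.ofReal (x.supp α u - y.supp α u) ≤ Metric.hausdorffEDist (x.cut α) (y.cut α) := by
  -- Compare a maximiser `a` in the cut of `x` with its nearest point `b` in the cut of `y`; since
  -- `u` is a unit vector, `⟨u, a - b⟩ ≤ ‖a - b‖`.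
  obtain ⟨a, ha, h⟩ := x.exists_inner_eq_supp hα u
  refine le_trans ?_ (Metric.infEDist_le_hausdorffEDist_of_mem ha)
  obtain ⟨b, hb, hab⟩ := (y.isCompact_cut hα).exists_infEDist_eq_edist (y.cut_nonempty hα) a
  rw [hab, edist_dist]
  refine ENNReal.ofReal_le_ofReal ?_
  have h1 := y.inner_le_supp hα u hb
  have h2 : inner ℝ (u : EuclideanSpace ℝ (Fin d)) (a - b) ≤ ‖a - b‖ := by
    simpa using real_inner_le_norm (u : EuclideanSpace ℝ (Fin d)) (a - b)
  rw [inner_sub_right] at h2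
  rw [dist_eq_norm]
  linarith

theorem enorm_supp_sub_le (x y : FuzzyVector d) {α : ℝ} (hα : α ∈ Set.Ioc (0 : ℝ) 1)
    (u : Metric.sphere (0 : EuclideanSpace ℝ (Fin d)) 1) :
    ‖x.supp α u - y.supp α u‖ₑ ≤ Metric.hausdorffEDist (x.cut α) (y.cut α) := by
  rw [Real.enorm_eq_ofReal_abs]
  rcases abs_cases (x.supp α u - y.supp α u) with ⟨h, -⟩ | ⟨h, -⟩
  · rw [h]; exact supp_le_supp_add_hausdorff x y hα u
  · rw [h, neg_sub, Metric.hausdorffEDist_comm]; exact supp_le_supp_add_hausdorff y x hα u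

theorem antitoneOn_supp (x : FuzzyVector d)
    (u : Metric.sphere (0 : EuclideanSpace ℝ (Fin d)) 1) :
    AntitoneOn (fun α => x.supp α u) (Set.Ioc 0 1) := by
  intro α hα β hβ h
  obtain ⟨a, ha, e⟩ := x.exists_inner_eq_supp hβ u
  simp only [← e]
  exact x.inner_le_supp hα u (x.cut_anti h ha)

/-- The support function is left-continuous in the level. -/
theorem exists_supp_lt (x : FuzzyVector d) {α : ℝ} (hα : α ∈ Set.Ioc (0 : ℝ) 1)
    (u : Metric.sphere (0 : EuclideanSpace ℝ (Fin d)) 1) {c : ℝ} (hc : x.supp α u < c) :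
    ∃ β ∈ Set.Ioo 0 α, x.supp β u < c := by
  by_contra! H
  have hβ : ∀ β : Set.Ioo 0 α, (β : ℝ) ∈ Set.Ioc (0 : ℝ) 1 := fun β =>
    ⟨β.2.1, β.2.2.le.trans hα.2⟩
  have : Nonempty (Set.Ioo 0 α) := ⟨⟨α / 2, half_pos hα.1, half_lt_self hα.1⟩⟩
  have hcl : IsClosed {a | c ≤ inner ℝ (u : EuclideanSpace ℝ (Fin d)) a} :=
    isClosed_le continuous_const (by fun_prop)
  -- Cantor's intersection theorem yields one point of all lower cuts, hence of the `α`-cut, with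
  -- inner product at least `c`.
  obtain ⟨a, ha⟩ := IsCompact.nonempty_iInter_of_directed_nonempty_isCompact_isClosed
    (fun β : Set.Ioo 0 α => x.cut β ∩ {a | c ≤ inner ℝ (u : EuclideanSpace ℝ (Fin d)) a})
    (Antitone.directed_ge fun β γ hle a ha => ⟨x.cut_anti hle ha.1, ha.2⟩)
    (fun β => by
      obtain ⟨a, ha, h⟩ := x.exists_inner_eq_supp (hβ β) u
      exact ⟨a, ha, (H β β.2).trans h.ge⟩)
    (fun β => (x.isCompact_cut (hβ β)).inter_right hcl)
    (fun β => (x.isCompact_cut (hβ β)).isClosed.inter hcl)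
  rw [Set.mem_iInter] at ha
  have h1 := x.inner_le_supp hα u (x.cut_left hα.1 a fun β hb => (ha ⟨β, hb⟩).1)
  have h2 : c ≤ inner ℝ (u : EuclideanSpace ℝ (Fin d)) a := (ha (Classical.arbitrary _)).2
  linarith

/-- A monotone function on a compact interval is integrable. The interval avoids level `0`, where
`cut` is the whole space because `ξ ≥ 0`. -/
theorem integrableOn_supp (x : FuzzyVector d)
    (u : Metric.sphere (0 : EuclideanSpace ℝ (Fin d)) 1) {a b : ℝ} (ha : 0 < a) (hb : b ≤ 1) :
    IntegrableOn (fun α => x.supp α u) (Set.Ioc a b) :=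
  (((x.antitoneOn_supp u).mono fun _ h => ⟨ha.trans_le h.1, h.2.trans hb⟩ :
    AntitoneOn _ (Set.Icc a b)).integrableOn_isCompact isCompact_Icc).mono_set
      Set.Ioc_subset_Icc_self

/-- The pointwise Hausdorff bound is integrated over levels; `p ≥ 1` enters through the comparison
of `L¹` and `Lᵖ` norms on the probability space `(0,1]`. -/
theorem enorm_integral_supp_sub_le {p : ℝ} (hp : 1 ≤ p) (x y : FuzzyVector d)
    (u : Metric.sphere (0 : EuclideanSpace ℝ (Fin d)) 1) {a b : ℝ} (ha : 0 < a) (hb : b ≤ 1) :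
    ‖(∫ α in Set.Ioc a b, x.supp α u) - ∫ α in Set.Ioc a b, y.supp α u‖ₑ ≤ dp p x y := by
  have hp0 : 0 < p := one_pos.trans_le hp
  rw [← integral_sub (x.integrableOn_supp u ha hb) (y.integrableOn_supp u ha hb)]
  have hm : AEStronglyMeasurable (fun α => x.supp α u - y.supp α u)
      (volume.restrict (Set.Ioc (0 : ℝ) 1)) :=
    ((aemeasurable_restrict_of_antitoneOn measurableSet_Ioc (x.antitoneOn_supp u)).sub
      (aemeasurable_restrict_of_antitoneOn measurableSet_Ioc
        (y.antitoneOn_supp u))).aestronglyMeasurable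
  have : IsProbabilityMeasure (volume.restrict (Set.Ioc (0 : ℝ) 1)) := ⟨by simp⟩
  calc ‖∫ α in Set.Ioc a b, (x.supp α u - y.supp α u)‖ₑ
      ≤ ∫⁻ α in Set.Ioc a b, ‖x.supp α u - y.supp α u‖ₑ := enorm_integral_le_lintegral_enorm _
    _ ≤ ∫⁻ α in Set.Ioc (0 : ℝ) 1, ‖x.supp α u - y.supp α u‖ₑ :=
        lintegral_mono_set (Set.Ioc_subset_Ioc ha.le hb)
    _ = eLpNorm (fun α => x.supp α u - y.supp α u) 1 (volume.restrict (Set.Ioc (0 : ℝ) 1)) :=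
        eLpNorm_one_eq_lintegral_enorm.symm
    _ ≤ eLpNorm (fun α => x.supp α u - y.supp α u) (ENNReal.ofReal p)
          (volume.restrict (Set.Ioc (0 : ℝ) 1)) :=
        eLpNorm_le_eLpNorm_of_exponent_le (by simpa using hp) hm
    _ ≤ dp p x y := by
        rw [eLpNorm_eq_lintegral_rpow_enorm_toReal (by simpa using hp0) ENNReal.ofReal_ne_top,
          ENNReal.toReal_ofReal hp0.le, dp]
        gcongr ?_ ^ (1 / p)
        refine setLIntegral_mono' measurableSet_Ioc fun α hα => ?_
        gcongr
        exact enorm_supp_sub_le x y hα u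

/-- A real function that is Lipschitz for `d_p` is Borel measurable. -/
theorem measurable_of_enorm_sub_le_dp {p : ℝ} {f : FuzzyVector d → ℝ}
    (hf : ∀ x y, ‖f x - f y‖ₑ ≤ dp p x y) : @Measurable _ _ (dpBorel d p) _ f := by
  let _ := dpTopology d p
  let _ : MeasurableSpace (FuzzyVector d) := dpBorel d p
  have : BorelSpace (FuzzyVector d) := ⟨rfl⟩
  refine Continuous.measurable ⟨fun U hU x hx => ?_⟩
  obtain ⟨ε, hε, h⟩ := EMetric.isOpen_iff.1 hU (f x) hx
  refine ⟨ε, hε, fun y hy => h ?_⟩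
  rw [Metric.mem_eball, edist_comm, edist_eq_enorm_sub]
  exact (hf x y).trans_lt hy

theorem measurable_supp {p : ℝ} (hp : 1 ≤ p) {α : ℝ} (hα : α ∈ Set.Ioc (0 : ℝ) 1)
    (u : Metric.sphere (0 : EuclideanSpace ℝ (Fin d)) 1) :
    @Measurable _ _ (dpBorel d p) _ (fun x : FuzzyVector d => x.supp α u) := by
  let _ : MeasurableSpace (FuzzyVector d) := dpBorel d p
  -- The shift by `2` keeps the window `(α - α/(n+2), α]` away from level `0`, already for `n = 0`.
  have he (n : ℕ) : α / (n + 2) ∈ Set.Ioo 0 α :=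
    ⟨div_pos hα.1 (by positivity), div_lt_self hα.1 (by linarith [n.cast_nonneg (α := ℝ)])⟩
  refine measurable_of_tendsto_metrizable
    (f := fun (n : ℕ) (x : FuzzyVector d) =>
      (α / (n + 2))⁻¹ * ∫ β in Set.Ioc (α - α / (n + 2)) α, x.supp β u) (fun n => ?_) ?_
  · exact (measurable_of_enorm_sub_le_dp fun x y =>
      enorm_integral_supp_sub_le hp x y u (sub_pos.2 (he n).2) hα.2).const_mul _
  rw [tendsto_pi_nhds]
  intro x
  have hI (n : ℕ) := x.integrableOn_supp u (sub_pos.2 (he n).2) hα.2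
  have hv (n : ℕ) : volume.real (Set.Ioc (α - α / (n + 2)) α) = α / (n + 2) := by
    rw [Real.volume_real_Ioc_of_le (by linarith [(he n).1])]; ring
  have hlow (n : ℕ) : x.supp α u ≤
      (α / (n + 2))⁻¹ * ∫ β in Set.Ioc (α - α / (n + 2)) α, x.supp β u := by
    rw [le_inv_mul_iff₀ (he n).1]
    calc _ = ∫ _ in Set.Ioc (α - α / (n + 2)) α, x.supp α u := by
          rw [setIntegral_const, hv, smul_eq_mul]
      _ ≤ _ := setIntegral_mono_on (by simp) (hI n) measurableSet_Ioc fun β hβ =>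
          x.antitoneOn_supp u ⟨(sub_pos.2 (he n).2).trans hβ.1, hβ.2.trans hα.2⟩ hα hβ.2
  have hup (n : ℕ) {γ : ℝ} (hγ : γ ∈ Set.Ioo 0 α) (hn : γ ≤ α - α / (n + 2)) :
      (α / (n + 2))⁻¹ * ∫ β in Set.Ioc (α - α / (n + 2)) α, x.supp β u ≤ x.supp γ u := by
    rw [inv_mul_le_iff₀ (he n).1]
    calc _ ≤ ∫ _ in Set.Ioc (α - α / (n + 2)) α, x.supp γ u :=
          setIntegral_mono_on (hI n) (by simp) measurableSet_Ioc fun β hβ =>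
          x.antitoneOn_supp u ⟨hγ.1, hγ.2.le.trans hα.2⟩
            ⟨(sub_pos.2 (he n).2).trans hβ.1, hβ.2.trans hα.2⟩ (hn.trans hβ.1.le)
      _ = _ := by rw [setIntegral_const, hv, smul_eq_mul]
  have hlim : Tendsto (fun n : ℕ => α - α / ((n : ℝ) + 2)) atTop (𝓝 α) := by
    have : Tendsto (fun n : ℕ => (n : ℝ) + 2) atTop atTop :=
      tendsto_atTop_add_const_right _ _ tendsto_natCast_atTop_atTop
    simpa using (this.const_div_atTop α).const_sub α
  -- By antitonicity the averages lie above the value at `α`, and below the value at any `γ < α`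
  -- once the window is to the right of `γ`.
  refine tendsto_order.2 ⟨fun c hc => .of_forall fun n => hc.trans_le (hlow n), fun c hc => ?_⟩
  obtain ⟨γ, hγ, hlt⟩ := x.exists_supp_lt hα u hc
  filter_upwards [hlim.eventually (lt_mem_nhds hγ.2)] with n hn
  exact (hup n hγ hn.le).trans_lt hlt

/-! ### Square integrability of support values from the Fréchet variance. -/

instance : IsFiniteMeasure (sphereMeasure d) := by
  unfold sphereMeasure
  -- If the surface measure vanishes, the factor `0⁻¹ = ∞` multiplies the zero measure.
  rcases eq_or_ne ((volume : Measure (EuclideanSpace ℝ (Fin d))).toSphere Set.univ) 0 with h | h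
  · rw [Measure.measure_univ_eq_zero.1 h, smul_zero]; infer_instance
  · exact Measure.smul_finite _ (ENNReal.inv_ne_top.2 h)

instance : (sphereMeasure d).IsOpenPosMeasure := by
  unfold sphereMeasure
  exact Measure.isOpenPosMeasure_smul _ (ENNReal.inv_ne_zero.2 (measure_ne_top _ _))

/-- The squared positive parts of the linear functionals of a vector `z` have a mean over the
sphere of order `‖z‖²`. -/
theorem exists_mul_norm_sq_le_integral_sphere (d : ℕ) :
    ∃ c : ℝ, 0 < c ∧ ∀ z : EuclideanSpace ℝ (Fin d), c * ‖z‖ ^ 2 ≤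
      ∫ v, (max (inner ℝ (v : EuclideanSpace ℝ (Fin d)) z) 0) ^ 2 ∂(sphereMeasure d) := by
  set h : EuclideanSpace ℝ (Fin d) → ℝ := fun z =>
    ∫ v, (max (inner ℝ (v : EuclideanSpace ℝ (Fin d)) z) 0) ^ 2 ∂(sphereMeasure d) with hh
  have hcont : Continuous h := by
    have := continuous_parametric_integral_of_continuous (μ := sphereMeasure d)
      (f := fun (z : EuclideanSpace ℝ (Fin d))
        (v : Metric.sphere (0 : EuclideanSpace ℝ (Fin d)) 1) =>
        (max (inner ℝ (v : EuclideanSpace ℝ (Fin d)) z) 0) ^ 2) (by fun_prop)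
      (isCompact_univ)
    simpa [hh] using this
  have hpos : ∀ z ∈ Metric.sphere (0 : EuclideanSpace ℝ (Fin d)) 1, 0 < h z := by
    intro z hz
    -- The continuous integrand equals `1` at `v = z`, and the measure charges every nonempty open
    -- set.
    refine Continuous.integral_pos_of_hasCompactSupport_nonneg_nonzero (x := ⟨z, hz⟩)
      (by fun_prop) (HasCompactSupport.of_compactSpace _) (fun v => by positivity) ?_
    have : ‖z‖ = 1 := by simpa using hz
    simp [this]
  obtain ⟨c, hc, hle⟩ : ∃ c : ℝ, 0 < c ∧
      ∀ z ∈ Metric.sphere (0 : EuclideanSpace ℝ (Fin d)) 1, c ≤ h z := by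
    rcases (Metric.sphere (0 : EuclideanSpace ℝ (Fin d)) 1).eq_empty_or_nonempty with he | hne
    · exact ⟨1, one_pos, by simp [he]⟩
    · obtain ⟨z, hz, hmin⟩ := (isCompact_sphere _ _).exists_isMinOn hne hcont.continuousOn
      exact ⟨h z, hpos z hz, fun w hw => hmin hw⟩
  refine ⟨c, hc, fun z => ?_⟩
  rcases eq_or_ne z 0 with rfl | hz
  · simp
  have hz' : 0 < ‖z‖ := norm_pos_iff.2 hz
  -- Homogeneity of degree two reduces the bound to the minimum over the unit sphere.
  have e : h z = ‖z‖ ^ 2 * h (‖z‖⁻¹ • z) := by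
    simp only [hh]
    rw [← integral_const_mul]
    congr 1 with v
    rw [inner_smul_right, ← mul_pow, mul_max_of_nonneg _ _ hz'.le, mul_zero,
      mul_inv_cancel_left₀ hz'.ne']
  change _ ≤ h z
  rw [e, mul_comm]
  gcongr
  exact hle _ (by simp [norm_smul, hz'.ne'])

/-- An upper bound suffices: it is used only in `⟨v, z⟩ ≤ s_x ≤ |s_x - s_m| + B`. -/
theorem exists_supp_le (m : FuzzyVector d) :
    ∃ B : ℝ, 0 ≤ B ∧ ∀ α ∈ Set.Ioc (0 : ℝ) 1,
      ∀ u : Metric.sphere (0 : EuclideanSpace ℝ (Fin d)) 1, m.supp α u ≤ B := by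
  obtain ⟨B, hB⟩ := m.bounded_supp.exists_norm_le
  refine ⟨max B 0, le_max_right _ _, fun α hα u => ?_⟩
  obtain ⟨a, ha, h⟩ := m.exists_inner_eq_supp hα u
  rw [← h]
  refine (real_inner_le_norm _ _).trans ?_
  simpa using Or.inl (hB a (m.cut_subset_supp hα.1 ha))

/-- A single value of the support function is controlled by the `L²`-distance of the support
functions. -/
theorem exists_enorm_supp_sq_le (m : FuzzyVector d) {α : ℝ} (hα : α ∈ Set.Ioc (0 : ℝ) 1)
    (u : Metric.sphere (0 : EuclideanSpace ℝ (Fin d)) 1) :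
    ∃ C D : ℝ≥0∞, C ≠ ∞ ∧ D ≠ ∞ ∧ ∀ x : FuzzyVector d,
      ‖x.supp α u‖ₑ ^ 2 ≤ C * rhoTwoSq x m + D := by
  obtain ⟨c, hc, hcz⟩ := exists_mul_norm_sq_le_integral_sphere d
  obtain ⟨B, hB, hmB⟩ := m.exists_supp_le
  set K : ℝ≥0∞ := ENNReal.ofReal α * ENNReal.ofReal c with hK
  have hK0 : K ≠ 0 := by simp [hK, hα.1, hc]
  have hKt : K ≠ ∞ := ENNReal.mul_ne_top ENNReal.ofReal_ne_top ENNReal.ofReal_ne_top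
  set E : ℝ≥0∞ := ENNReal.ofReal (2 * B ^ 2) * sphereMeasure d Set.univ with hE
  have hEt : E ≠ ∞ := ENNReal.mul_ne_top ENNReal.ofReal_ne_top (measure_ne_top _ _)
  refine ⟨K⁻¹ * 2, K⁻¹ * (E * ENNReal.ofReal α), ENNReal.mul_ne_top (ENNReal.inv_ne_top.2 hK0)
    (by simp), ENNReal.mul_ne_top (ENNReal.inv_ne_top.2 hK0)
      (ENNReal.mul_ne_top hEt ENNReal.ofReal_ne_top), fun x => ?_⟩
  obtain ⟨z, hz, hzu⟩ := x.exists_inner_eq_supp hα u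
  have h1 : ‖x.supp α u‖ₑ ^ 2 ≤ ENNReal.ofReal (‖z‖ ^ 2) := by
    rw [← hzu, Real.enorm_eq_ofReal_abs, ← ENNReal.ofReal_pow (abs_nonneg _)]
    refine ENNReal.ofReal_le_ofReal ?_
    gcongr
    simpa using abs_real_inner_le_norm (u : EuclideanSpace ℝ (Fin d)) z
  -- Cuts grow as the level drops, so `z` lies in the `β`-cut. The factors `2` come from `(r + B)² ≤
  -- 2r² + 2B²`.
  have h2 : ∀ β ∈ Set.Ioc 0 α, ENNReal.ofReal (c * ‖z‖ ^ 2) ≤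
      2 * (∫⁻ v, ‖x.supp β v - m.supp β v‖ₑ ^ 2 ∂(sphereMeasure d)) + E := by
    intro β hβ
    have hβ1 : β ∈ Set.Ioc (0 : ℝ) 1 := ⟨hβ.1, hβ.2.trans hα.2⟩
    calc ENNReal.ofReal (c * ‖z‖ ^ 2)
        ≤ ENNReal.ofReal
          (∫ v, (max (inner ℝ (v : EuclideanSpace ℝ (Fin d)) z) 0) ^ 2 ∂(sphereMeasure d)) :=
          ENNReal.ofReal_le_ofReal (hcz z)
      _ = ∫⁻ v, ENNReal.ofReal ((max (inner ℝ (v : EuclideanSpace ℝ (Fin d)) z) 0) ^ 2)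
            ∂(sphereMeasure d) := by
          refine ofReal_integral_eq_lintegral_ofReal ?_ (.of_forall fun v => by positivity)
          exact Continuous.integrable_of_hasCompactSupport (by fun_prop)
            (HasCompactSupport.of_compactSpace _)
      _ ≤ ∫⁻ v, (2 * ‖x.supp β v - m.supp β v‖ₑ ^ 2 + ENNReal.ofReal (2 * B ^ 2))
            ∂(sphereMeasure d) := by
          refine lintegral_mono fun v => ?_
          have two (r : ℝ) : 2 * ENNReal.ofReal r = ENNReal.ofReal (2 * r) := by
            rw [ENNReal.ofReal_mul (by norm_num), ENNReal.ofReal_ofNat]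
          rw [Real.enorm_eq_ofReal_abs, ← ENNReal.ofReal_pow (abs_nonneg _), sq_abs, two,
            ← ENNReal.ofReal_add (by positivity) (by positivity)]
          refine ENNReal.ofReal_le_ofReal ?_
          have i1 := x.inner_le_supp hβ1 v (x.cut_anti hβ.2 hz)
          have i2 := hmB β hβ1 v
          rcases le_total (inner ℝ (v : EuclideanSpace ℝ (Fin d)) z) 0 with h | h
          · rw [max_eq_right h, zero_pow two_ne_zero]; positivity
          · rw [max_eq_left h]
            have : (inner ℝ (v : EuclideanSpace ℝ (Fin d)) z) ^ 2 ≤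
                (|x.supp β v - m.supp β v| + B) ^ 2 := by
              gcongr
              linarith [le_abs_self (x.supp β v - m.supp β v)]
            nlinarith [sq_abs (x.supp β v - m.supp β v),
              sq_nonneg (|x.supp β v - m.supp β v| - B)]
      _ = _ := by
          rw [lintegral_add_right _ measurable_const, lintegral_const_mul' _ _ (by simp),
            lintegral_const]
  -- Integrating over the levels `(0, α]`, of total length `α`, explains `K = αc`.
  have h3 : K * ENNReal.ofReal (‖z‖ ^ 2) ≤ 2 * rhoTwoSq x m + E * ENNReal.ofReal α := by
    calc K * ENNReal.ofReal (‖z‖ ^ 2)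
        = ∫⁻ _ in Set.Ioc 0 α, ENNReal.ofReal (c * ‖z‖ ^ 2) := by
          rw [setLIntegral_const, Real.volume_Ioc, sub_zero, ENNReal.ofReal_mul hc.le, hK]
          ring
      _ ≤ ∫⁻ β in Set.Ioc 0 α,
            (2 * (∫⁻ v, ‖x.supp β v - m.supp β v‖ₑ ^ 2 ∂(sphereMeasure d)) + E) :=
          setLIntegral_mono' measurableSet_Ioc h2
      _ = 2 * (∫⁻ β in Set.Ioc 0 α,
            ∫⁻ v, ‖x.supp β v - m.supp β v‖ₑ ^ 2 ∂(sphereMeasure d)) + E * ENNReal.ofReal α := by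
          rw [lintegral_add_right _ measurable_const, lintegral_const_mul' _ _ (by simp),
            setLIntegral_const, Real.volume_Ioc, sub_zero]
      _ ≤ _ := by
          gcongr
          exact lintegral_mono_set (Set.Ioc_subset_Ioc_right hα.2)
  calc ‖x.supp α u‖ₑ ^ 2 ≤ ENNReal.ofReal (‖z‖ ^ 2) := h1
    _ = K⁻¹ * (K * ENNReal.ofReal (‖z‖ ^ 2)) := by
        rw [← mul_assoc, ENNReal.inv_mul_cancel hK0 hKt, one_mul]
    _ ≤ K⁻¹ * (2 * rhoTwoSq x m + E * ENNReal.ofReal α) := by gcongr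
    _ = _ := by ring

/-- Finite Fréchet variance makes every value of the support function square integrable. -/
theorem memLp_two_supp {Ω : Type*} [MeasurableSpace Ω] {P : Measure Ω} [IsFiniteMeasure P]
    {X : Ω → FuzzyVector d} {m : FuzzyVector d} (hvar : frechetVariance P X m < ∞)
    {α : ℝ} (hα : α ∈ Set.Ioc (0 : ℝ) 1) (u : Metric.sphere (0 : EuclideanSpace ℝ (Fin d)) 1)
    (hm : AEStronglyMeasurable (fun ω => (X ω).supp α u) P) :
    MemLp (fun ω => (X ω).supp α u) 2 P := by
  obtain ⟨C, D, hC, hD, h⟩ := m.exists_enorm_supp_sq_le hα u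
  refine ⟨hm, ?_⟩
  rw [eLpNorm_lt_top_iff_lintegral_rpow_enorm_lt_top (by simp) (by simp)]
  calc ∫⁻ ω, ‖(X ω).supp α u‖ₑ ^ (2 : ℝ≥0∞).toReal ∂P
      ≤ ∫⁻ ω, (C * rhoTwoSq (X ω) m + D) ∂P :=
        lintegral_mono fun ω => by simpa using h (X ω)
    _ = C * frechetVariance P X m + D * P Set.univ := by
        rw [lintegral_add_right _ measurable_const, lintegral_const_mul' _ _ hC, lintegral_const,
          frechetVariance]
    _ < ∞ := ENNReal.add_lt_top.2 ⟨ENNReal.mul_lt_top hC.lt_top hvar,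
        ENNReal.mul_lt_top hD.lt_top (measure_lt_top _ _)⟩

end FuzzyVector

/-! ### Products of characteristic functions and the Gaussian limit. -/

theorem norm_prod_sub_prod_le_sum {ι R : Type*} [NormedCommRing R] [NormOneClass R]
    (s : Finset ι) (f g : ι → R)
    (hf : ∀ i ∈ s, ‖f i‖ ≤ 1) (hg : ∀ i ∈ s, ‖g i‖ ≤ 1) :
    ‖∏ i ∈ s, f i - ∏ i ∈ s, g i‖ ≤ ∑ i ∈ s, ‖f i - g i‖ := by
  classical
  induction s using Finset.induction_on with
  | empty => simp
  | insert a s ha ih =>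
    rw [Finset.prod_insert ha, Finset.prod_insert ha, Finset.sum_insert ha]
    have hg' : ‖∏ i ∈ s, g i‖ ≤ 1 :=
      (Finset.norm_prod_le _ _).trans
        (Finset.prod_le_one (fun _ _ => norm_nonneg _) fun i hi => hg i (by simp [hi]))
    have ih' := ih (fun i hi => hf i (by simp [hi])) (fun i hi => hg i (by simp [hi]))
    calc ‖f a * ∏ i ∈ s, f i - g a * ∏ i ∈ s, g i‖
        = ‖(f a - g a) * ∏ i ∈ s, g i + f a * (∏ i ∈ s, f i - ∏ i ∈ s, g i)‖ := by ring_nf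
      _ ≤ ‖f a - g a‖ * ‖∏ i ∈ s, g i‖ + ‖f a‖ * ‖∏ i ∈ s, f i - ∏ i ∈ s, g i‖ :=
          (norm_add_le _ _).trans (add_le_add (norm_mul_le _ _) (norm_mul_le _ _))
      _ ≤ ‖f a - g a‖ * 1 + 1 * ‖∏ i ∈ s, f i - ∏ i ∈ s, g i‖ := by
          gcongr
          exact hf a (by simp)
      _ ≤ _ := by linarith

/-- The characteristic function of a centred random variable with unit variance agrees with the
Gaussian one up to second order at the origin. -/
theorem charFun_sub_exp_isLittleO {Ω : Type*} [MeasurableSpace Ω] {P : Measure Ω}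
    [IsProbabilityMeasure P] {X : Ω → ℝ} (hX : AEMeasurable X P) (h0 : P[X] = 0)
    (h1 : P[X ^ 2] = 1) :
    (fun t : ℝ => charFun (P.map X) t - Complex.exp (-t ^ 2 / 2)) =o[𝓝 0] fun t => t ^ 2 := by
  -- The standard Gaussian has the same second-order Taylor polynomial, which cancels in the
  -- difference.
  have hG : (fun t : ℝ => charFun ((gaussianReal 0 1).map id) t - (1 - t ^ 2 / 2))
      =o[𝓝 0] fun t => t ^ 2 := by
    refine taylor_charFun_two aemeasurable_id (by simp) ?_
    have := variance_id_gaussianReal (μ := 0) (v := 1)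
    rw [variance_eq_integral aemeasurable_id] at this
    simpa using this
  refine ((taylor_charFun_two hX h0 h1).sub hG).congr_left fun t => ?_
  rw [Measure.map_id, charFun_gaussianReal]
  simp [neg_div]

/-- **Lindeberg's argument** for weighted sums: the products of the characteristic functions
along an infinitesimal array of weights converge to the Gaussian characteristic function. -/
theorem tendsto_prod_charFun {Ω : Type*} [MeasurableSpace Ω] {P : Measure Ω}
    [IsProbabilityMeasure P] {X : Ω → ℝ} (hX : AEMeasurable X P) (h0 : P[X] = 0)
    (h1 : P[X ^ 2] = 1) {s : ℕ → Finset ℕ} {a : ℕ → ℕ → ℝ} {A : ℕ → ℝ}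
    (ha : ∀ n j, |a n j| ≤ A n) (hA : Tendsto A atTop (𝓝 0)) {v : ℝ}
    (hv : Tendsto (fun n => ∑ j ∈ s n, a n j ^ 2) atTop (𝓝 v)) :
    Tendsto (fun n => ∏ j ∈ s n, charFun (P.map X) (a n j)) atTop
      (𝓝 (Complex.exp (-v / 2))) := by
  have := Measure.isProbabilityMeasure_map (μ := P) hX
  have hexp : Tendsto (fun n => ∏ j ∈ s n, Complex.exp (-(a n j) ^ 2 / 2)) atTop
      (𝓝 (Complex.exp (-v / 2))) := by
    have e (n : ℕ) : ∏ j ∈ s n, Complex.exp (-(a n j) ^ 2 / 2) =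
        Complex.exp (-((∑ j ∈ s n, a n j ^ 2 : ℝ) : ℂ) / 2) := by
      rw [← Complex.exp_sum]
      push_cast
      rw [← Finset.sum_div, Finset.sum_neg_distrib]
    simp_rw [e]
    refine (Complex.continuous_exp.tendsto _).comp (Tendsto.div_const (Tendsto.neg ?_) 2)
    exact (Complex.continuous_ofReal.tendsto _).comp hv
  suffices h : Tendsto (fun n => ∏ j ∈ s n, charFun (P.map X) (a n j) -
      ∏ j ∈ s n, Complex.exp (-(a n j) ^ 2 / 2)) atTop (𝓝 0) by
    simpa using h.add hexp
  rw [Metric.tendsto_atTop']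
  suffices h : ∀ ε > 0, ∀ᶠ n in atTop, ‖∏ j ∈ s n, charFun (P.map X) (a n j) -
      ∏ j ∈ s n, Complex.exp (-(a n j) ^ 2 / 2)‖ < ε by
    intro ε hε
    obtain ⟨N, hN⟩ := eventually_atTop.1 (h ε hε)
    exact ⟨N, fun n hn => by simpa using hN n hn.le⟩
  intro ε hε
  -- The sum of the squared weights is eventually below `|v| + 1`, so this precision per factor adds
  -- up to less than `ε`.
  have hc : 0 < ε / (|v| + 1) := by positivity
  have hlo := (charFun_sub_exp_isLittleO hX h0 h1).def hc
  obtain ⟨δ, hδ, hball⟩ := Metric.eventually_nhds_iff.1 hlo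
  filter_upwards [hA.eventually (gt_mem_nhds hδ),
    hv.eventually (gt_mem_nhds (show v < |v| + 1 by linarith [le_abs_self v]))] with n hn hvn
  calc _ ≤ ∑ j ∈ s n, ‖charFun (P.map X) (a n j) - Complex.exp (-(a n j) ^ 2 / 2)‖ := by
        refine norm_prod_sub_prod_le_sum _ _ _ (fun j _ => norm_charFun_le_one _) fun j _ => ?_
        rw [Complex.norm_exp, Real.exp_le_one_iff]
        norm_cast
        nlinarith [sq_nonneg (a n j)]
    _ ≤ ∑ j ∈ s n, ε / (|v| + 1) * a n j ^ 2 := by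
        refine Finset.sum_le_sum fun j _ => ?_
        have := hball (y := a n j) (by simpa using (ha n j).trans_lt hn)
        simpa using this
    _ = ε / (|v| + 1) * ∑ j ∈ s n, a n j ^ 2 := by rw [Finset.mul_sum]
    _ < ε / (|v| + 1) * (|v| + 1) := by gcongr
    _ = ε := by field_simp

/-! ### Interpolation weights and their asymptotic covariance. -/

/-- The part of the unit interval `[j, j + 1]` below `x`, as a length. -/
noncomputable def unitOverlap (x : ℝ) (j : ℕ) : ℝ := max 0 (min (x - j) 1)

theorem unitOverlap_nonneg (x : ℝ) (j : ℕ) : 0 ≤ unitOverlap x j := le_max_left _ _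

theorem unitOverlap_le_one (x : ℝ) (j : ℕ) : unitOverlap x j ≤ 1 :=
  max_le zero_le_one (min_le_right _ _)

theorem unitOverlap_of_lt_floor {x : ℝ} {j : ℕ} (h : j < ⌊x⌋₊) : unitOverlap x j = 1 := by
  have h1 : ((j + 1 : ℕ) : ℝ) ≤ x := (Nat.le_floor_iff' (by simp)).1 h
  push_cast at h1
  rw [unitOverlap, min_eq_right (by linarith), max_eq_right zero_le_one]

theorem unitOverlap_floor {x : ℝ} (hx : 0 ≤ x) : unitOverlap x ⌊x⌋₊ = x - ⌊x⌋₊ := by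
  have h1 := Nat.floor_le hx
  have h2 := Nat.lt_floor_add_one x
  rw [unitOverlap, min_eq_left (by linarith), max_eq_right (by linarith)]

theorem unitOverlap_of_floor_lt {x : ℝ} {j : ℕ} (h : ⌊x⌋₊ < j) : unitOverlap x j = 0 := by
  have h1 : x < j := (Nat.floor_lt' (by omega)).1 h
  rw [unitOverlap, min_eq_left (by linarith), max_eq_left (by linarith)]

/-- Linear interpolation of partial sums as a weighted sum. -/
theorem sum_unitOverlap_mul {x : ℝ} (hx : 0 ≤ x) {M : ℕ} (hM : ⌊x⌋₊ < M) (f : ℕ → ℝ) :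
    ∑ j ∈ Finset.range M, unitOverlap x j * f j =
      ∑ j ∈ Finset.range ⌊x⌋₊, f j + (x - ⌊x⌋₊) * f ⌊x⌋₊ := by
  rw [← Finset.sum_subset (Finset.range_mono (Nat.succ_le_of_lt hM)), Finset.sum_range_succ,
    unitOverlap_floor hx]
  · congr 1
    refine Finset.sum_congr rfl fun j hj => ?_
    rw [unitOverlap_of_lt_floor (Finset.mem_range.1 hj), one_mul]
  · intro j _ hj
    rw [unitOverlap_of_floor_lt (by simpa using hj), zero_mul]

/-- For `x ≤ y` each full interval below `x` contributes exactly `1`. Only the interval containing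
`x` causes an error, its fractional part being multiplied by a number in `[0,1]`. -/
theorem abs_sum_unitOverlap_mul_sub_le {x y : ℝ} (hx : 0 ≤ x) (hy : 0 ≤ y) {M : ℕ}
    (hMx : ⌊x⌋₊ < M) (hMy : ⌊y⌋₊ < M) :
    |∑ j ∈ Finset.range M, unitOverlap x j * unitOverlap y j - min x y| ≤ 1 := by
  wlog hxy : x ≤ y generalizing x y
  · simpa [mul_comm, min_comm] using this hy hx hMy hMx (le_of_not_ge hxy)
  rw [min_eq_left hxy, sum_unitOverlap_mul hx hMx, Finset.sum_congr rfl fun j hj =>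
    unitOverlap_of_lt_floor ((Finset.mem_range.1 hj).trans_le (Nat.floor_le_floor hxy))]
  have h1 := Nat.floor_le hx
  have h2 := Nat.lt_floor_add_one x
  have h3 := unitOverlap_nonneg y ⌊x⌋₊
  have h4 := unitOverlap_le_one y ⌊x⌋₊
  simp only [Finset.sum_const, Finset.card_range, nsmul_eq_mul, mul_one]
  rw [abs_le]
  constructor <;> nlinarith

theorem tendsto_inv_mul_sum_unitOverlap {s t T : ℝ} (hs : 0 ≤ s) (ht : 0 ≤ t) (hsT : s ≤ T)
    (htT : t ≤ T) :
    Tendsto (fun n : ℕ => (n : ℝ)⁻¹ * ∑ j ∈ Finset.range (⌊n * T⌋₊ + 1),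
      unitOverlap (n * s) j * unitOverlap (n * t) j) atTop (𝓝 (min s t)) := by
  rw [tendsto_iff_norm_sub_tendsto_zero]
  refine squeeze_zero' (.of_forall fun _ => norm_nonneg _) ?_
    (tendsto_inv_atTop_zero.comp (tendsto_natCast_atTop_atTop (R := ℝ)))
  filter_upwards [eventually_gt_atTop 0] with n hn
  have hn' : (0 : ℝ) < n := by exact_mod_cast hn
  have hfl {r : ℝ} (hr : r ≤ T) : ⌊n * r⌋₊ < ⌊n * T⌋₊ + 1 :=
    Nat.lt_succ_of_le (Nat.floor_le_floor (by gcongr))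
  have h := abs_sum_unitOverlap_mul_sub_le (x := n * s) (y := n * t) (by positivity)
    (by positivity) (hfl hsT) (hfl htT)
  rw [← mul_min_of_nonneg _ _ hn'.le] at h
  have e (S : ℝ) : (n : ℝ)⁻¹ * S - min s t = (n : ℝ)⁻¹ * (S - n * min s t) := by
    field_simp
  rw [e, norm_mul, Real.norm_eq_abs, Real.norm_eq_abs, abs_of_pos (inv_pos.2 hn')]
  simpa using mul_le_mul_of_nonneg_left h (inv_pos.2 hn').le

/-! ### Finite-dimensional convergence of the real interpolated walk. -/

/-- The joint characteristic function of the finite-dimensional laws of a Brownian motion. -/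
theorem ProbabilityTheory.IsPreBrownianReal.charFun_map_toLp {Ω : Type*} [MeasurableSpace Ω]
    {P : Measure Ω} {b : ℝ≥0 → Ω → ℝ} (hb : IsPreBrownianReal b P) {ι : Type*} [Fintype ι]
    (t : ι → ℝ≥0) (θ : EuclideanSpace ℝ ι) :
    charFun (P.map fun ω => WithLp.toLp 2 fun i => b (t i) ω) θ =
      Complex.exp (-((∑ i, ∑ l, θ i * θ l * (min (t i) (t l) : ℝ) : ℝ) : ℂ) / 2) := by
  have := hb.isGaussianProcess.isProbabilityMeasure
  have hG : HasGaussianLaw (fun ω => WithLp.toLp 2 fun i => b (t i) ω) P := by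
    have := (hb.isGaussianProcess.comp_right t).hasGaussianLaw Finset.univ
    exact (this.map (ContinuousLinearMap.pi fun i : ι =>
      ContinuousLinearMap.proj (R := ℝ) (φ := fun _ : (Finset.univ : Finset ι) => ℝ)
        ⟨i, Finset.mem_univ i⟩)).toLp_pi 2
  have hin (ω : Ω) : inner ℝ θ (WithLp.toLp 2 fun i => b (t i) ω) = ∑ i, θ i * b (t i) ω := by
    simp [PiLp.inner_apply, mul_comm]
  have hL (i : ι) : MemLp (fun ω => θ i * b (t i) ω) 2 P :=
    (hb.isGaussianProcess.hasGaussianLaw_eval (t i)).memLp_two.const_mul _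
  rw [hG.charFun_map_eq]
  simp_rw [hin]
  rw [integral_finsetSum _ fun i _ => (hb.integrable_eval (t i)).const_mul _,
    variance_fun_sum hL]
  simp_rw [integral_const_mul, hb.integral_eval, covariance_const_mul_left,
    covariance_const_mul_right, hb.covariance_fun_eval]
  simp [neg_div, mul_assoc]

/-- The linearly interpolated and rescaled random walk of independent, identically distributed,
centred steps of unit variance converges to Brownian motion in finite-dimensional
distributions. -/
theorem tendstoInDistribution_interpolated_walk {Ω Ω' : Type*} [MeasurableSpace Ω]
    [MeasurableSpace Ω'] {P : Measure Ω} [IsProbabilityMeasure P] {P' : Measure Ω'}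
    [IsProbabilityMeasure P'] {Y : ℕ → Ω → ℝ} (h0 : P[Y 0] = 0) (h1 : P[Y 0 ^ 2] = 1)
    (hindep : iIndepFun Y P) (hident : ∀ i, IdentDistrib (Y i) (Y 0) P P)
    {b : ℝ≥0 → Ω' → ℝ} (hb : IsPreBrownianReal b P') {ι : Type*} [Fintype ι] (t : ι → ℝ≥0) :
    TendstoInDistribution
      (fun (n : ℕ) (ω : Ω) (i : ι) => (√n)⁻¹ *
        (∑ j ∈ Finset.range ⌊n * t i⌋₊, Y j ω + ((n * t i : ℝ) - ⌊n * t i⌋₊) * Y ⌊n * t i⌋₊ ω))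
      atTop (fun ω' i => b (t i) ω') (fun _ => P) P' := by
  have hY i := (hident i).aemeasurable_fst
  have hW (n : ℕ) : AEMeasurable (fun ω => WithLp.toLp 2 fun i : ι => (√n)⁻¹ *
        (∑ j ∈ Finset.range ⌊n * t i⌋₊, Y j ω +
          ((n * t i : ℝ) - ⌊n * t i⌋₊) * Y ⌊n * t i⌋₊ ω)) P := by
    fun_prop
  have hB : AEMeasurable (fun ω' => WithLp.toLp 2 fun i : ι => b (t i) ω') P' := by
    have := fun s => hb.aemeasurable s
    fun_prop
  -- Move to the Euclidean norm, whose inner product the characteristic function needs.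
  suffices h : TendstoInDistribution
      (fun (n : ℕ) (ω : Ω) => WithLp.toLp 2 fun i : ι => (√n)⁻¹ *
        (∑ j ∈ Finset.range ⌊n * t i⌋₊, Y j ω + ((n * t i : ℝ) - ⌊n * t i⌋₊) * Y ⌊n * t i⌋₊ ω))
      atTop (fun ω' => WithLp.toLp 2 fun i : ι => b (t i) ω') (fun _ => P) P' from
    h.continuous_comp (g := WithLp.ofLp) (PiLp.continuous_ofLp 2 _)
  refine ⟨hW, hB, ?_⟩
  refine ProbabilityMeasure.tendsto_iff_tendsto_charFun.2 fun θ => ?_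
  simp only [ProbabilityMeasure.coe_mk]
  rw [hb.charFun_map_toLp t θ]
  -- Any common upper bound of the times would do; the sum also covers an empty index set.
  set T : ℝ := ∑ i, (t i : ℝ) with hT
  have htT (i : ι) : (t i : ℝ) ≤ T :=
    Finset.single_le_sum (f := fun i => (t i : ℝ)) (fun _ _ => NNReal.coe_nonneg _)
      (Finset.mem_univ i)
  -- The total weight of the step `Y j` in the pairing of `θ` with the rescaled walk.
  set a : ℕ → ℕ → ℝ := fun n j => (√n)⁻¹ * ∑ i, θ i * unitOverlap (n * t i) j with ha
  have hfl (n : ℕ) (i : ι) : ⌊(n * t i : ℝ)⌋₊ < ⌊n * T⌋₊ + 1 :=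
    Nat.lt_succ_of_le (Nat.floor_le_floor (by gcongr; exact htT i))
  have hfloor (n : ℕ) (i : ι) : ⌊(n * t i : ℝ≥0)⌋₊ = ⌊(n * t i : ℝ)⌋₊ := by
    exact (Nonneg.nat_floor_coe (n * t i : ℝ≥0)).symm
  have hlin (n : ℕ) (ω : Ω) : ∑ i, θ i * ((√n)⁻¹ *
      (∑ j ∈ Finset.range ⌊n * t i⌋₊, Y j ω + ((n * t i : ℝ) - ⌊n * t i⌋₊) * Y ⌊n * t i⌋₊ ω)) =
      ∑ j ∈ Finset.range (⌊n * T⌋₊ + 1), a n j * Y j ω := by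
    simp_rw [hfloor]
    simp_rw [← sum_unitOverlap_mul (show (0 : ℝ) ≤ n * t _ by positivity) (hfl n _)
      fun j => Y j ω]
    simp_rw [ha, Finset.mul_sum, Finset.sum_mul]
    rw [Finset.sum_comm]
    refine Finset.sum_congr rfl fun j _ => Finset.sum_congr rfl fun i _ => by ring
  have hchar (n : ℕ) : charFun (P.map fun ω => WithLp.toLp 2 fun i : ι => (√n)⁻¹ *
        (∑ j ∈ Finset.range ⌊n * t i⌋₊, Y j ω +
          ((n * t i : ℝ) - ⌊n * t i⌋₊) * Y ⌊n * t i⌋₊ ω)) θ =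
      ∏ j ∈ Finset.range (⌊n * T⌋₊ + 1), charFun (P.map (Y 0)) (a n j) := by
    have e1 : charFun (P.map fun ω => WithLp.toLp 2 fun i : ι => (√n)⁻¹ *
        (∑ j ∈ Finset.range ⌊n * t i⌋₊, Y j ω +
          ((n * t i : ℝ) - ⌊n * t i⌋₊) * Y ⌊n * t i⌋₊ ω)) θ =
        charFun (P.map fun ω => ∑ j ∈ Finset.range (⌊n * T⌋₊ + 1), a n j * Y j ω) 1 := by
      rw [charFun_apply, charFun_apply, integral_map (hW n) (by fun_prop),
        integral_map (by fun_prop) (by fun_prop)]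
      congr 1 with ω
      rw [← hlin]
      simp [PiLp.inner_apply]
    rw [e1, iIndepFun.charFun_map_fun_finsetSum_eq_prod (X := fun j ω => a n j * Y j ω)
      (fun j _ => (hY j).const_mul _)
      ((hindep.comp (fun j y => a n j * y) (fun j => measurable_const_mul _)).restrict _)]
    rw [Finset.prod_apply]
    refine Finset.prod_congr rfl fun j _ => ?_
    rw [charFun_map_mul_comp (hY j), mul_one, (hident j).map_eq]
  simp_rw [hchar]
  refine tendsto_prod_charFun (hY 0) h0 h1 (A := fun n => (√n)⁻¹ * ∑ i, |θ i|) (fun n j => ?_) ?_ ?_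
  · rw [ha, abs_mul, abs_of_nonneg (by positivity : 0 ≤ (√(n : ℝ))⁻¹)]
    gcongr
    refine (Finset.abs_sum_le_sum_abs _ _).trans (Finset.sum_le_sum fun i _ => ?_)
    rw [abs_mul, abs_of_nonneg (unitOverlap_nonneg _ _)]
    exact mul_le_of_le_one_right (abs_nonneg _) (unitOverlap_le_one _ _)
  · have : Tendsto (fun n : ℕ => (√(n : ℝ))⁻¹) atTop (𝓝 0) :=
      tendsto_inv_atTop_zero.comp (Real.tendsto_sqrt_atTop.comp tendsto_natCast_atTop_atTop)
    simpa using this.mul_const (∑ i, |θ i|)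
  -- Expanding the square gives a quadratic form in `θ` whose coefficients tend to `min (t i) (t
  -- l)`.
  · have hsq (n : ℕ) : ∑ j ∈ Finset.range (⌊n * T⌋₊ + 1), a n j ^ 2 =
        ∑ i, ∑ l, θ i * θ l * ((n : ℝ)⁻¹ * ∑ j ∈ Finset.range (⌊n * T⌋₊ + 1),
          unitOverlap (n * t i) j * unitOverlap (n * t l) j) := by
      simp_rw [ha, mul_pow, inv_pow, Real.sq_sqrt (Nat.cast_nonneg (α := ℝ) n), sq,
        Finset.sum_mul_sum, Finset.mul_sum]
      rw [Finset.sum_comm]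
      refine Finset.sum_congr rfl fun i _ => ?_
      rw [Finset.sum_comm]
      refine Finset.sum_congr rfl fun l _ => Finset.sum_congr rfl fun j _ => by ring
    simp_rw [hsq]
    exact tendsto_finsetSum _ fun i _ => tendsto_finsetSum _ fun l _ =>
      (tendsto_inv_mul_sum_unitOverlap (t i).2 (t l).2 (htT i) (htT l)).const_mul _

/-! ### Reduction of the fuzzy walk to the real one. -/

theorem mainTheorem1 {d : ℕ} (hd : 1 < d) {p : ℝ} (hp : 1 ≤ p)
    {Ω : Type*} [MeasurableSpace Ω] (P : Measure Ω) [IsProbabilityMeasure P]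
    (X : ℕ → Ω → FuzzyVector d)
    (hmeas : ∀ i, @Measurable Ω (FuzzyVector d) _ (FuzzyVector.dpBorel d p) (X i))
    (hindep : iIndepFun (m := fun _ => FuzzyVector.dpBorel d p) X P)
    (hident : ∀ i, @IdentDistrib Ω Ω (FuzzyVector d) _ _ (FuzzyVector.dpBorel d p)
      (X i) (X 0) P P)
    (m : FuzzyVector d)
    (hmean : ∀ i, FuzzyVector.IsBochnerExpectation P (X i) m)
    (hvar : ∀ i, FuzzyVector.frechetVariance P (X i) m < ⊤)
    (α : ℝ) (hα : α ∈ Set.Ioc (0 : ℝ) 1)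
    (u : Metric.sphere (0 : EuclideanSpace ℝ (Fin d)) 1)
    (hσ : evariance (fun ω => (X 0 ω).supp α u) P ≠ 0)
    {Ω' : Type*} [MeasurableSpace Ω'] (P' : Measure Ω') [IsProbabilityMeasure P']
    (b : ℝ≥0 → Ω' → ℝ) (hb : IsBrownianReal b P')
    (k : ℕ) (t : Fin k → ℝ≥0) (ht : StrictMono t) :
    TendstoInDistribution
      (fun (n : ℕ) (ω : Ω) (i : Fin k) =>
        FuzzyVector.centredSupp (fun j => X j ω) m
          (√(variance (fun ω' => (X 0 ω').supp α u) P)) n (t i) α u)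
      atTop (fun (ω' : Ω') (i : Fin k) => b (t i) ω') (fun _ => P) P' := by
  have hY : MemLp (fun ω => (X 0 ω).supp α u) 2 P :=
    FuzzyVector.memLp_two_supp (hvar 0) hα u (hmean 0 α hα u).1.aestronglyMeasurable
  set V : ℝ := variance (fun ω => (X 0 ω).supp α u) P with hV
  have hVpos : 0 < V := by
    rw [hV, variance, ENNReal.toReal_pos_iff]
    exact ⟨pos_iff_ne_zero.2 hσ, hY.evariance_lt_top⟩
  have hμ : ∫ ω, (X 0 ω).supp α u ∂P = m.supp α u := (hmean 0 α hα u).2.symm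
  -- The standardised step is a Borel function of the fuzzy variable, so independence and equality
  -- of laws pass to it.
  have hf : @Measurable _ _ (FuzzyVector.dpBorel d p) _
      (fun x : FuzzyVector d => (x.supp α u - m.supp α u) / √V) := by
    let _ := FuzzyVector.dpBorel d p
    exact ((FuzzyVector.measurable_supp hp hα u).sub_const _).div_const _
  simp_rw [FuzzyVector.centredSupp_eq _ m (Real.sqrt_nonneg V) _ _ hα u]
  let _ := FuzzyVector.dpBorel d p
  refine tendstoInDistribution_interpolated_walk
    (Y := fun j ω => ((X j ω).supp α u - m.supp α u) / √V) ?_ ?_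
    (hindep.comp (fun _ x => (x.supp α u - m.supp α u) / √V) fun _ => hf)
    (fun i => (hident i).comp hf) hb.toIsPreBrownianReal t
  · rw [integral_div, integral_sub (hmean 0 α hα u).1 (integrable_const _), hμ]
    simp
  · simp only [Pi.pow_apply, div_pow]
    rw [integral_div, ← hμ, ← variance_eq_integral hY.aestronglyMeasurable.aemeasurable,
      Real.sq_sqrt hVpos.le, ← hV, div_self hVpos.ne']
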